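/- **Setting.** Let $D$ be a finitely generated abelian group and let $S=\bigoplus_{d\in D}S_d$ be a $D$-graded integral domain whose grading is effective ($D$ is generated by $\{d : S_d\neq 0\}$). A nonzero homogeneous nonunit $f\in S$ is a *$D$-prime element* if for all homogeneous $g,h\in S$, $f\mid gh$ implies $f\mid g$ or $f\mid h$. Assume that $S$ is *factorially $D$-graded*: every nonzero homogeneous nonunit is a product of $D$-prime elements. A proper graded ideal $\mathfrak p$ of $S$ is *$D$-prime* if for all homogeneous $g,h\in S$, $gh\in\mathfrak p$ implies $g\in\mathfrak p$ or $h\in\mathfrak p$. A homogeneous element $f\in S$ is *relevant* if the degrees of the homogeneous units of the localization $S_f$ form a subgroup of finite index of $D$; the *irrelevant ideal* $S_+$ is the ideal generated by all relevant elements. Let $B$ be an ideal of $S$ with $B\subseteq S_+$ (so $(S,B)$ is a *conical ring*). Let $\mathrm{Proj}_D^B(S)$ be the set of $D$-prime ideals $\mathfrak p$ of $S$ with $B\not\subseteq\mathfrak p$. For $E\subseteq S$ put $V_+(E)=V_B(E)=\{\mathfrak p\in \mathrm{Proj}_D^B(S) : E\subseteq\mathfrak p\}$, and give $\mathrm{Proj}_D^B(S)$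 the homogeneous Zariski topology, whose closed sets are the $V_+(E)$ with $E$ a set of homogeneous elements. For $Y\subseteq\mathrm{Proj}_D^B(S)$ let $I_B(Y)=\{f\in B : f\in\mathfrak p \text{ for all }\mathfrak p\in Y\}$. Let $\mathrm{Proj}^D_B(S)$ be (the underlying space of) the union of the spectra $\mathrm{Spec}(S_{(f)})$ of the degree-zero localizations $S_{(f)}=(S_f)_0$, for $f\in B$ relevant, glued along the $\mathrm{Spec}(S_{(fg)})$. **Theorem (Multigraded Nullstellensatz).** (a) Let $E\subseteq B$ be a subset and let $\mathfrak a$ be the graded ideal generated by $E$, i.e. the smallest graded ideal of $S$ containing $E$ (if the elements of $E$ are homogeneous, this is the ideal $(E)$). If $\mathfrak a$ is a radical ideal, then $$I_B(V_B(E))=\mathrm{rad}(\mathfrak a)\cap B .$$ (b) For every subset $Y\subseteq \mathrm{Proj}_D^B(S)$, the closure of $Y$ in the homogeneous Zariski topology is $\overline{Y}=V_+(I_B(Y))$. The same holds for every subset $Y\subseteq\mathrm{Proj}^D_B(S)$ under the canonical identification of points with $D$-prime ideals. Precisely, there is an open topological embedding $\varphi:\mathrm{Proj}^D_B(S)\to\mathrm{Proj}_D^B(S)$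 that sends each point $\mathfrak q\in\mathrm{Spec}(S_{(f)})$, $f\in B$ relevant, to a $D$-prime ideal $\mathfrak p$ with $f\notin\mathfrak p$ and $\mathfrak pS_f\cap S_{(f)}=\mathfrak q$; it is surjective, hence a homeomorphism, if $B$ is a graded ideal; and $\overline{Y}=\varphi^{-1}\bigl(V_+(I_B(\varphi(Y)))\bigr)$ for every $Y\subseteq\mathrm{Proj}^D_B(S)$. -/

import Mathlib

namespace MultigradedProj

variable {D S : Type*} [AddCommGroup D] [DecidableEq D] [CommRing S]
variable (𝒜 : D → AddSubgroup S)

/-- The grading is effective: the grading group is generated by the support of the ring. -/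
def IsEffective : Prop :=
  AddSubgroup.closure {d : D | 𝒜 d ≠ ⊥} = ⊤

/-- A `D`-prime element: a nonzero homogeneous nonunit that has the prime property with respect
to products of homogeneous elements. -/
def IsDPrimeElem (f : S) : Prop :=
  SetLike.IsHomogeneousElem 𝒜 f ∧ f ≠ 0 ∧ ¬ IsUnit f ∧
    ∀ g h : S, SetLike.IsHomogeneousElem 𝒜 g → SetLike.IsHomogeneousElem 𝒜 h →
      f ∣ g * h → f ∣ g ∨ f ∣ h

/-- Factorially `D`-graded: every nonzero homogeneous nonunit is a product of `D`-prime
elements. -/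
def IsFactoriallyGraded : Prop :=
  ∀ f : S, SetLike.IsHomogeneousElem 𝒜 f → f ≠ 0 → ¬ IsUnit f →
    ∃ s : Multiset S, (∀ p ∈ s, IsDPrimeElem 𝒜 p) ∧ s.prod = f

variable [GradedRing 𝒜]

/-- A `D`-prime ideal: a proper graded ideal that has the prime property with respect to products
of homogeneous elements. -/
structure IsDPrime (p : Ideal S) : Prop where
  isHomogeneous : p.IsHomogeneous 𝒜
  ne_top : p ≠ ⊤
  mem_or_mem : ∀ g h : S, SetLike.IsHomogeneousElem 𝒜 g → SetLike.IsHomogeneousElem 𝒜 h →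
    g * h ∈ p → g ∈ p ∨ h ∈ p

/-! ### Relevant elements and the irrelevant ideal -/

/-- The degree `d` part of the localization `S_f`, for `f` homogeneous of degree `e`: the
fractions `a / f ^ n` with `a` homogeneous of degree `d + n e`. -/
def awayDegree (f : S) (e d : D) : Set (Localization.Away f) :=
  {x | ∃ (n : ℕ) (a : S), a ∈ 𝒜 (d + n • e) ∧
    x = Localization.mk a (⟨f ^ n, n, rfl⟩ : Submonoid.powers f)}

/-- The support group `D^f` of a homogeneous element `f` of degree `e`: the degrees of the
homogeneous units of the localization `S_f`. -/
def supportGroup {f : S} {e : D} (hf : f ∈ 𝒜 e) : AddSubgroup D where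
  carrier := {d | ∃ x ∈ awayDegree 𝒜 f e d, IsUnit x}
  zero_mem' := ⟨1, ⟨0, 1, by simpa using SetLike.one_mem_graded 𝒜, by
    rw [← Localization.mk_one]; congr 1; ext; simp⟩, isUnit_one⟩
  add_mem' := by
    rintro d d' ⟨_, ⟨n, a, ha, rfl⟩, hx⟩ ⟨_, ⟨m, b, hb, rfl⟩, hy⟩
    refine ⟨_, ⟨n + m, a * b, ?_, ?_⟩, hx.mul hy⟩
    · have h := SetLike.mul_mem_graded ha hb
      rwa [show d + n • e + (d' + m • e) = d + d' + (n + m) • e by rw [add_smul]; abel] at h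
    · rw [Localization.mk_mul]
      congr 1
      ext
      simp [pow_add]
  neg_mem' := by
    rintro d ⟨_, ⟨n, a, ha, rfl⟩, hx⟩
    obtain ⟨y, hy⟩ := hx.exists_right_inv
    induction y using Localization.induction_on with
    | H y =>
      obtain ⟨b, ⟨_, m, rfl⟩⟩ := y
      rw [Localization.mk_mul, ← Localization.mk_one, Localization.mk_eq_mk_iff,
        Localization.r_iff_exists] at hy
      obtain ⟨⟨_, k, rfl⟩, hk⟩ := hy
      -- the component of `b` of the degree that the inverse has to have
      set c : S := (DirectSum.decompose 𝒜 b (-d + m • e) : S) with hc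
      have hcm : c ∈ 𝒜 (-d + m • e) := SetLike.coe_mem _
      have key : f ^ k * (a * c) = f ^ (k + (n + m)) := by
        have hfa : f ^ k * a ∈ 𝒜 (k • e + (d + n • e)) :=
          SetLike.mul_mem_graded (SetLike.pow_mem_graded k hf) ha
        have h1 := DirectSum.coe_decompose_mul_add_of_left_mem 𝒜
          (j := -d + m • e) (b := b) hfa
        have h2 : f ^ k * a * b = f ^ (k + (n + m)) := by
          simp only [Submonoid.coe_mul, OneMemClass.coe_one, one_mul, mul_one] at hk
          rw [mul_assoc, hk, pow_add, pow_add]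
        have h3 : k • e + (d + n • e) + (-d + m • e) = (k + (n + m)) • e := by
          simp only [add_smul]; abel
        rw [h2, h3, DirectSum.decompose_of_mem_same 𝒜 (SetLike.pow_mem_graded _ hf)] at h1
        rw [h1, mul_assoc]
      refine ⟨_, ⟨m, c, hcm, rfl⟩, ?_⟩
      refine IsUnit.of_mul_eq_one (Localization.mk a ⟨f ^ n, n, rfl⟩) ?_
      rw [mul_comm, Localization.mk_mul, ← Localization.mk_one, Localization.mk_eq_mk_iff,
        Localization.r_iff_exists]
      refine ⟨⟨f ^ k, k, rfl⟩, ?_⟩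
      simp only [Submonoid.coe_mul, OneMemClass.coe_one, one_mul, mul_one]
      rw [key, pow_add, pow_add]

/-- A relevant element: `f` is homogeneous and the degrees of the homogeneous units of `S_f` form
a subgroup of finite index of `D`. -/
def IsRelevant (f : S) : Prop :=
  ∃ (e : D) (hf : f ∈ 𝒜 e), (supportGroup 𝒜 hf).FiniteIndex

/-- The irrelevant ideal `S_+`, generated by all relevant elements. -/
def irrelevantIdeal : Ideal S :=
  Ideal.span {f | IsRelevant 𝒜 f}

/-! ### The multihomogeneous `D`-prime spectrum of a conical ring -/

/-- The multihomogeneous `D`-prime spectrum of `(S, B)`: all `D`-prime ideals of `S` that do not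
contain `B`. -/
def DProj (B : Ideal S) : Type _ :=
  {p : Ideal S // IsDPrime 𝒜 p ∧ ¬ B ≤ p}

variable {𝒜} {B : Ideal S}

/-- The `D`-prime ideal `𝔭_y` of a point `y`. -/
def DProj.asIdeal (y : DProj 𝒜 B) : Ideal S := y.1

/-- The vanishing locus `V_+(E) = V_B(E)` in the multihomogeneous `D`-prime spectrum of
`(S, B)`. -/
def zeroLocus (E : Set S) : Set (DProj 𝒜 B) :=
  {y | E ⊆ (y.asIdeal : Set S)}

/-- The `B`-vanishing ideal `I_B(Y)`: the elements of `B` that lie in `𝔭_y` for all `y ∈ Y`. -/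
def vanishingIdeal (Y : Set (DProj 𝒜 B)) : Set S :=
  {f | f ∈ B ∧ Y ⊆ zeroLocus {f}}

/-- The homogeneous Zariski topology: the closed sets are the sets `V_+(E)` for sets `E` of
homogeneous elements. -/
instance : TopologicalSpace (DProj 𝒜 B) :=
  TopologicalSpace.ofClosed
    {Z | ∃ E : Set S, (∀ f ∈ E, SetLike.IsHomogeneousElem 𝒜 f) ∧ Z = zeroLocus E}
    ⟨{1}, by
      rintro _ rfl
      exact ⟨0, SetLike.one_mem_graded 𝒜⟩, by
      refine (Set.eq_empty_of_forall_notMem fun y hy => y.2.1.ne_top ?_).symm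
      exact (Ideal.eq_top_iff_one _).2 (hy rfl)⟩
    (by
      intro A hA
      refine ⟨{f | SetLike.IsHomogeneousElem 𝒜 f ∧ ∃ Z ∈ A, Z ⊆ zeroLocus {f}},
        fun f hf => hf.1, ?_⟩
      ext y
      constructor
      · rintro hy f ⟨-, Z, hZ, hf⟩
        exact hf (hy Z hZ) rfl
      · intro hy Z hZ
        obtain ⟨E, hE, rfl⟩ := hA hZ
        exact fun f hf => hy ⟨hE f hf, _, hZ, fun z hz g hg => by
          rw [Set.mem_singleton_iff.1 hg]; exact hz hf⟩)
    (by
      rintro _ ⟨E, hE, rfl⟩ _ ⟨E', hE', rfl⟩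
      refine ⟨{x | ∃ f ∈ E, ∃ g ∈ E', x = f * g}, ?_, ?_⟩
      · rintro _ ⟨f, hf, g, hg, rfl⟩
        obtain ⟨i, hi⟩ := hE f hf
        obtain ⟨j, hj⟩ := hE' g hg
        exact ⟨i + j, SetLike.mul_mem_graded hi hj⟩
      · ext y
        constructor
        · rintro (hy | hy) _ ⟨f, hf, g, hg, rfl⟩
          · exact Ideal.mul_mem_right _ _ (hy hf)
          · exact Ideal.mul_mem_left _ _ (hy hg)
        · intro hy
          by_contra hcon
          rw [Set.mem_union, not_or] at hcon
          obtain ⟨f, hf, hfy⟩ := Set.not_subset.1 hcon.1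
          obtain ⟨g, hg, hgy⟩ := Set.not_subset.1 hcon.2
          exact (y.2.1.mem_or_mem f g (hE f hf) (hE' g hg) (hy ⟨f, hf, g, hg, rfl⟩)).elim hfy hgy)

/-! ### The underlying space of the `D`-graded Proj of a conical ring -/

variable (𝒜 B)

/-- The relevant elements that lie in `B`. -/
def RelevantIn : Type _ :=
  {f : S // IsRelevant 𝒜 f ∧ f ∈ B}

/-- The disjoint union of the spectra of the degree zero localizations `S_(f)`, for `f` relevant
in `B`. -/
abbrev ProjCharts : Type _ :=
  Σ f : RelevantIn 𝒜 B, PrimeSpectrum (HomogeneousLocalization.Away 𝒜 f.1)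

/-- Points of `Spec S_(f)` and `Spec S_(g)` are glued if they are the images of one point of
`Spec S_(fg)`. -/
def ProjGlue (x y : ProjCharts 𝒜 B) : Prop :=
  ∃ (d e : D) (hf : x.1.1 ∈ 𝒜 d) (hg : y.1.1 ∈ 𝒜 e)
    (r : PrimeSpectrum (HomogeneousLocalization.Away 𝒜 (x.1.1 * y.1.1))),
    PrimeSpectrum.comap (HomogeneousLocalization.awayMap 𝒜 hg rfl) r = x.2 ∧
    PrimeSpectrum.comap (HomogeneousLocalization.awayMap 𝒜 hf (mul_comm _ _)) r = y.2

/-- The underlying topological space of the `D`-graded Proj of `(S, B)`, that is of the union of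
the `Spec S_(f)` for `f ∈ B` relevant, glued along the `Spec S_(fg)`. -/
abbrev ProjSpace : Type _ := Quot (ProjGlue 𝒜 B)

variable {𝒜 B}

/-- The ideal `𝔭 S_f ∩ S_(f)` of `S_(f)`. -/
noncomputable def degreeZeroTrace (f : S) (p : Ideal S) :
    Ideal (HomogeneousLocalization.Away 𝒜 f) :=
  (p.map (algebraMap S (Localization.Away f))).comap
    (algebraMap (HomogeneousLocalization.Away 𝒜 f) (Localization.Away f))

/-- A map from the `D`-graded Proj to the `D`-prime spectrum is the canonical identification if,
on each chart `Spec S_(f)`, it is inverse to `𝔭 ↦ 𝔭 S_f ∩ S_(f)`. -/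
def IsCanonical (φ : ProjSpace 𝒜 B → DProj 𝒜 B) : Prop :=
  ∀ x : ProjCharts 𝒜 B, x.1.1 ∉ (φ (Quot.mk _ x)).asIdeal ∧
    degreeZeroTrace x.1.1 (φ (Quot.mk _ x)).asIdeal = x.2.asIdeal

end MultigradedProj

namespace MultigradedProj

open HomogeneousLocalization

variable {D S : Type*} [AddCommGroup D] [DecidableEq D] [CommRing S]
variable {𝒜 : D → AddSubgroup S} [GradedRing 𝒜]

/-! ### Existence of `D`-prime ideals and the vanishing ideal -/

section DPrime

/-! For (a), if `f ∈ B` is outside the radical graded hull of `E`, so is some component of `f`. Zorn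
gives a `D`-prime `p` over the hull avoiding that component, hence avoiding `f`; as `f ∈ B`, `p` is
a point of `V_B(E)`. For the closure formula, a homogeneous `g` vanishing on `Y` is tested at a
point `p` through `g * b` with `b ∈ B`, `b ∉ p`.

The space glued from charts is compared through `chartIdeal`, which spreads a prime of `S_(f)` to a
`D`-prime of `S`. It is inverse to the trace by `degreeZeroTrace_chartIdeal` and
`chartIdeal_degreeZeroTrace`; only the latter needs `f` relevant. Hence two chart points are glued
exactly when their `D`-primes agree, and the map is open onto its image, so the closure formula
pulls back along it. -/

theorem IsDPrime.mul_mem_iff {p : Ideal S} (hp : IsDPrime 𝒜 p) {g h : S}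
    (hg : SetLike.IsHomogeneousElem 𝒜 g) (hh : SetLike.IsHomogeneousElem 𝒜 h) :
    g * h ∈ p ↔ g ∈ p ∨ h ∈ p :=
  ⟨hp.mem_or_mem g h hg hh, fun H => H.elim (Ideal.mul_mem_right _ _) (Ideal.mul_mem_left _ _)⟩

theorem IsDPrime.pow_mem {p : Ideal S} (hp : IsDPrime 𝒜 p) {g : S}
    (hg : SetLike.IsHomogeneousElem 𝒜 g) {n : ℕ} (h : g ^ n ∈ p) : g ∈ p := by
  induction n with
  | zero => exact absurd ((Ideal.eq_top_iff_one _).2 (by simpa using h)) hp.ne_top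
  | succ n ih =>
    rw [pow_succ] at h
    obtain ⟨i, hi⟩ := hg
    exact (hp.mem_or_mem _ _ ⟨_, SetLike.pow_mem_graded n hi⟩ ⟨i, hi⟩ h).elim ih id

/-- The prime property needs only one homogeneous factor. -/
theorem IsDPrime.mem_or_mem_of_left {p : Ideal S} (hp : IsDPrime 𝒜 p) {g h : S}
    (hg : SetLike.IsHomogeneousElem 𝒜 g) (hgh : g * h ∈ p) : g ∈ p ∨ h ∈ p := by
  by_contra! hcon
  obtain ⟨i, hi⟩ := hg
  refine hcon.2 (hp.isHomogeneous.mem_iff.2 fun j => ?_)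
  have h1 := hp.isHomogeneous (i + j) hgh
  rw [DirectSum.coe_decompose_mul_add_of_left_mem 𝒜 hi] at h1
  exact (hp.mem_or_mem _ _ ⟨i, hi⟩ ⟨j, SetLike.coe_mem _⟩ h1).resolve_left hcon.1

/-- A graded ideal that contains no power of a homogeneous element `h` is contained in a
`D`-prime ideal that does not contain `h`. -/
theorem exists_isDPrime_of_forall_pow_notMem {a : Ideal S} (ha : a.IsHomogeneous 𝒜) {h : S}
    (hpow : ∀ n : ℕ, h ^ n ∉ a) :
    ∃ p : Ideal S, IsDPrime 𝒜 p ∧ a ≤ p ∧ h ∉ p := by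
  obtain ⟨p, hap, hp⟩ := zorn_le_nonempty₀
    {I : Ideal S | I.IsHomogeneous 𝒜 ∧ ∀ n : ℕ, h ^ n ∉ I}
    (fun c hc hchain I hI => by
      refine ⟨sSup c, ⟨Ideal.IsHomogeneous.sSup fun J hJ => (hc hJ).1, fun n hn => ?_⟩,
        fun J hJ => le_sSup hJ⟩
      obtain ⟨J, hJ, hn⟩ := (Submodule.mem_sSup_of_directed ⟨I, hI⟩ hchain.directedOn).1 hn
      exact (hc hJ).2 n hn) a ⟨ha, hpow⟩
  have key : ∀ g, SetLike.IsHomogeneousElem 𝒜 g → g ∉ p → ∃ n, h ^ n ∈ p ⊔ Ideal.span {g} := by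
    intro g hg hgp
    by_contra! hcon
    -- Enlarging the maximal `p` by a homogeneous `g ∉ p` keeps it graded, so it must capture a
    -- power of `h`.
    refine hgp (hp.le_of_ge ⟨hp.prop.1.sup (Ideal.homogeneous_span 𝒜 _ ?_), hcon⟩ le_sup_left
      (Ideal.mem_sup_right (Ideal.mem_span_singleton_self g)))
    rintro x rfl
    exact hg
  refine ⟨p, ⟨hp.prop.1, fun htop => hp.prop.2 0 (htop ▸ Submodule.mem_top), ?_⟩, hap,
    fun hmem => hp.prop.2 1 (by simpa using hmem)⟩
  intro g g' hg hg' hgg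
  by_contra! hcon
  obtain ⟨n, hn⟩ := key g hg hcon.1
  obtain ⟨m, hm⟩ := key g' hg' hcon.2
  refine hp.prop.2 (n + m) ?_
  rw [pow_add]
  refine (Ideal.mul_le.2 ?_ : (p ⊔ Ideal.span {g}) * (p ⊔ Ideal.span {g'}) ≤ p)
    (Ideal.mul_mem_mul hn hm)
  intro x hx y hy
  obtain ⟨u, hu, v, hv, rfl⟩ := Submodule.mem_sup.1 hx
  obtain ⟨u', hu', v', hv', rfl⟩ := Submodule.mem_sup.1 hy
  obtain ⟨s, rfl⟩ := Ideal.mem_span_singleton'.1 hv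
  obtain ⟨s', rfl⟩ := Ideal.mem_span_singleton'.1 hv'
  rw [show (u + s * g) * (u' + s' * g') = (u' + s' * g') * u + s * g * u' + s * s' * (g * g') by
    ring]
  exact add_mem (add_mem (Ideal.mul_mem_left _ _ hu) (Ideal.mul_mem_left _ _ hu'))
    (Ideal.mul_mem_left _ _ hgg)

end DPrime

section Vanishing

variable {B : Ideal S}

theorem mem_vanishingIdeal {Y : Set (DProj 𝒜 B)} {f : S} :
    f ∈ vanishingIdeal Y ↔ f ∈ B ∧ ∀ y ∈ Y, f ∈ y.asIdeal :=
  and_congr_right fun _ => forall₂_congr fun _ _ => Set.singleton_subset_iff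

theorem mem_zeroLocus {E : Set S} {y : DProj 𝒜 B} :
    y ∈ zeroLocus E ↔ ∀ f ∈ E, f ∈ y.asIdeal :=
  Iff.rfl

/-- With torsion in `D`, the radical of a graded ideal need not be graded. Radicality of the hull
lets the argument pass from `f` to one of its components. -/
theorem vanishingIdeal_zeroLocus {E : Set S}
    (hE : ((Ideal.span E).homogeneousHull 𝒜).toIdeal.IsRadical) :
    vanishingIdeal (zeroLocus E : Set (DProj 𝒜 B)) =
      (((Ideal.span E).homogeneousHull 𝒜).toIdeal.radical : Set S) ∩ B := by
  set a := (Ideal.span E).homogeneousHull 𝒜 with ha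
  rw [hE.radical]
  ext f
  rw [mem_vanishingIdeal]
  constructor
  · rintro ⟨hfB, hf⟩
    refine ⟨?_, hfB⟩
    by_contra hfa
    obtain ⟨d, hd⟩ : ∃ d, (DirectSum.decompose 𝒜 f d : S) ∉ a.toIdeal := by
      by_contra! hcon
      exact hfa (a.isHomogeneous.mem_iff.2 hcon)
    obtain ⟨p, hp, hap, hdp⟩ := exists_isDPrime_of_forall_pow_notMem a.isHomogeneous
      (h := (DirectSum.decompose 𝒜 f d : S)) fun n hn => hd (hE ⟨n, hn⟩)
    have hfp : f ∉ p := fun h => hdp (hp.isHomogeneous d h)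
    -- `f` itself witnesses that `B` is not contained in `p`.
    exact hfp (hf ⟨p, hp, fun h => hfp (h hfB)⟩ fun g hg =>
      hap (Ideal.le_toIdeal_homogeneousHull 𝒜 _ (Ideal.subset_span hg)))
  · rintro ⟨hfa, hfB⟩
    refine ⟨hfB, fun y hy => ?_⟩
    have hle : a ≤ (⟨y.asIdeal, y.2.1.isHomogeneous⟩ : HomogeneousIdeal 𝒜) :=
      (Ideal.homogeneousHull.gc 𝒜 _ _).2 (Ideal.span_le.2 hy)
    exact hle hfa

theorem isClosed_iff_zeroLocus {Z : Set (DProj 𝒜 B)} :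
    IsClosed Z ↔ ∃ E : Set S, (∀ f ∈ E, SetLike.IsHomogeneousElem 𝒜 f) ∧ Z = zeroLocus E := by
  rw [← isOpen_compl_iff]
  change Zᶜᶜ ∈ _ ↔ _
  rw [compl_compl]
  rfl

/-- Point ideals are graded, so `E` can be replaced by the set of components of its elements. -/
theorem isClosed_zeroLocus (E : Set S) : IsClosed (zeroLocus E : Set (DProj 𝒜 B)) := by
  rw [isClosed_iff_zeroLocus]
  refine ⟨{x | ∃ f ∈ E, ∃ d, x = (DirectSum.decompose 𝒜 f d : S)}, ?_, ?_⟩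
  · rintro _ ⟨f, -, d, rfl⟩
    exact ⟨d, SetLike.coe_mem _⟩
  · ext y
    constructor
    · rintro hy _ ⟨f, hf, d, rfl⟩
      exact y.2.1.isHomogeneous d (hy hf)
    · exact fun hy f hf => y.2.1.isHomogeneous.mem_iff.2 fun d => hy ⟨f, hf, d, rfl⟩

theorem closure_eq_zeroLocus_vanishingIdeal (Y : Set (DProj 𝒜 B)) :
    closure Y = zeroLocus (vanishingIdeal Y) := by
  refine Set.Subset.antisymm (closure_minimal (fun y hy f hf => (mem_vanishingIdeal.1 hf).2 y hy)
    (isClosed_zeroLocus _)) fun p hp => ?_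
  obtain ⟨E, hE, hYE⟩ := isClosed_iff_zeroLocus.1 (isClosed_closure (s := Y))
  rw [hYE]
  intro g hg
  obtain ⟨b, hb, hbp⟩ := SetLike.not_le_iff_exists.1 p.2.2
  -- `b` need not be homogeneous, so the one-sided prime property is used.
  refine (p.2.1.mem_or_mem_of_left (hE g hg) (hp (mem_vanishingIdeal.2
    ⟨B.mul_mem_left g hb, fun y hy => Ideal.mul_mem_right _ _ ?_⟩))).resolve_right hbp
  have : y ∈ zeroLocus E := hYE ▸ subset_closure hy
  exact this hg

theorem isOpen_notMem (f : S) : IsOpen {y : DProj 𝒜 B | f ∉ y.asIdeal} := by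
  rw [← isClosed_compl_iff]
  convert! isClosed_zeroLocus (𝒜 := 𝒜) (B := B) {f} using 1
  ext y
  simp [mem_zeroLocus]

end Vanishing

/-! ### Relevant elements -/

section Relevant

/-- Turns support groups into divisibility statements in `S`. -/
theorem isUnit_mk_powers_iff {f a : S} {n : ℕ} :
    IsUnit (Localization.mk a (⟨f ^ n, n, rfl⟩ : Submonoid.powers f)) ↔ ∃ m, a ∣ f ^ m := by
  constructor
  · intro h
    obtain ⟨y, hy⟩ := h.exists_right_inv
    induction y using Localization.induction_on with
    | H y =>
      obtain ⟨b, ⟨_, m, rfl⟩⟩ := y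
      rw [Localization.mk_mul, ← Localization.mk_one, Localization.mk_eq_mk_iff,
        Localization.r_iff_exists] at hy
      obtain ⟨⟨_, k, rfl⟩, hk⟩ := hy
      simp only [Submonoid.coe_mul, OneMemClass.coe_one, one_mul, mul_one] at hk
      exact ⟨k + (n + m), f ^ k * b, by rw [pow_add, pow_add, ← hk]; ring⟩
  · rintro ⟨m, b, hb⟩
    refine IsUnit.of_mul_eq_one (Localization.mk (b * f ^ n) ⟨f ^ m, m, rfl⟩) ?_
    rw [Localization.mk_mul, ← Localization.mk_one, Localization.mk_eq_mk_iff,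
      Localization.r_iff_exists]
    refine ⟨1, ?_⟩
    simp only [Submonoid.coe_mul, OneMemClass.coe_one, one_mul, mul_one]
    rw [hb]
    ring

theorem mem_supportGroup {f : S} {e d : D} (hf : f ∈ 𝒜 e) :
    d ∈ supportGroup 𝒜 hf ↔ ∃ (n : ℕ) (a : S), a ∈ 𝒜 (d + n • e) ∧ ∃ m, a ∣ f ^ m := by
  constructor
  · rintro ⟨_, ⟨n, a, ha, rfl⟩, hx⟩
    exact ⟨n, a, ha, isUnit_mk_powers_iff.1 hx⟩
  · rintro ⟨n, a, ha, hx⟩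
    exact ⟨_, ⟨n, a, ha, rfl⟩, isUnit_mk_powers_iff.2 hx⟩

theorem IsRelevant.mul_left {f g : S} (hf : IsRelevant 𝒜 f)
    (hg : SetLike.IsHomogeneousElem 𝒜 g) : IsRelevant 𝒜 (g * f) := by
  obtain ⟨e, hf, hfin⟩ := hf
  obtain ⟨e', hg⟩ := hg
  refine ⟨e' + e, SetLike.mul_mem_graded hg hf, ?_⟩
  -- The support group can only grow: a unit `a / f ^ n` is rewritten as `a * g ^ n / (g * f) ^ n`.
  refine AddSubgroup.finiteIndex_of_le (H := supportGroup 𝒜 hf) fun d hd => ?_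
  obtain ⟨n, a, ha, m, ham⟩ := (mem_supportGroup hf).1 hd
  refine (mem_supportGroup _).2 ⟨n, a * g ^ n, ?_, m + n, ?_⟩
  · have := SetLike.mul_mem_graded ha (SetLike.pow_mem_graded n hg)
    rwa [show d + n • e + n • e' = d + n • (e' + e) by rw [smul_add]; abel] at this
  · obtain ⟨c, hc⟩ := ham
    exact ⟨c * g ^ m * f ^ n, by rw [mul_pow, pow_add, pow_add, hc]; ring⟩

/-- Some power of a homogeneous element can be moved into the degrees `l • e` by a homogeneous
divisor of a power of a relevant element. -/
theorem exists_mem_graded_dvd_pow {f : S} {e : D} (hf : f ∈ 𝒜 e)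
    (hfin : (supportGroup 𝒜 hf).FiniteIndex) (d : D) :
    ∃ (N l : ℕ) (c : S), c ∈ 𝒜 (l • e - (N + 1) • d) ∧ ∃ m, c ∣ f ^ m := by
  -- The index of the support group annihilates the quotient of `D`; finiteness makes it nonzero,
  -- hence of the form `N + 1`.
  obtain ⟨l, c, hc, hm⟩ := (mem_supportGroup hf).1
    (neg_mem ((supportGroup 𝒜 hf).nsmul_index_mem d))
  obtain ⟨N, hN⟩ := Nat.exists_eq_succ_of_ne_zero hfin.index_ne_zero
  refine ⟨N, l, c, ?_, hm⟩
  rwa [hN, neg_add_eq_sub] at hc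

end Relevant

/-! ### Fractions of degree zero -/

section Away

variable {f : S} {e : D} (hf : f ∈ 𝒜 e)

theorem awayMk_eq_of_mul_eq {n m : ℕ} {a b : S} (ha : a ∈ 𝒜 (n • e)) (hb : b ∈ 𝒜 (m • e))
    (h : a * f ^ m = b * f ^ n) : Away.mk 𝒜 hf n a ha = Away.mk 𝒜 hf m b hb := by
  ext
  rw [Away.val_mk, Away.val_mk, Localization.mk_eq_mk_iff, Localization.r_iff_exists]
  refine ⟨1, ?_⟩
  simp only [OneMemClass.coe_one, one_mul]
  rw [mul_comm, h, mul_comm]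

theorem awayMk_congr {n : ℕ} {a b : S} (h : a = b) (ha : a ∈ 𝒜 (n • e)) :
    Away.mk 𝒜 hf n a ha = Away.mk 𝒜 hf n b (h ▸ ha) := by
  subst h; rfl

theorem awayMk_add {n : ℕ} {a b : S} (ha : a ∈ 𝒜 (n • e)) (hb : b ∈ 𝒜 (n • e)) :
    Away.mk 𝒜 hf n (a + b) (add_mem ha hb) = Away.mk 𝒜 hf n a ha + Away.mk 𝒜 hf n b hb := by
  ext
  rw [val_add, Away.val_mk, Away.val_mk, Away.val_mk, Localization.add_mk_self]

theorem awayMk_zero (n : ℕ) : Away.mk 𝒜 hf n 0 (zero_mem _) = 0 := by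
  ext
  rw [Away.val_mk, val_zero, Localization.mk_zero]

theorem mul_mem_graded_nsmul {n m : ℕ} {a b : S} (ha : a ∈ 𝒜 (n • e)) (hb : b ∈ 𝒜 (m • e)) :
    a * b ∈ 𝒜 ((n + m) • e) := by
  rw [add_smul]; exact SetLike.mul_mem_graded ha hb

theorem awayMk_mul {n m : ℕ} {a b : S} (ha : a ∈ 𝒜 (n • e)) (hb : b ∈ 𝒜 (m • e)) :
    Away.mk 𝒜 hf n a ha * Away.mk 𝒜 hf m b hb =
      Away.mk 𝒜 hf (n + m) (a * b) (mul_mem_graded_nsmul ha hb) := by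
  ext
  rw [val_mul, Away.val_mk, Away.val_mk, Away.val_mk, Localization.mk_mul]
  congr 1
  ext
  simp [pow_add]

theorem awayMk_self : Away.mk 𝒜 hf 1 f (by simpa using hf) = 1 := by
  ext
  rw [Away.val_mk, val_one, ← Localization.mk_one, Localization.mk_eq_mk_iff,
    Localization.r_iff_exists]
  exact ⟨1, by simp⟩

end Away

/-! ### The trace of a `D`-prime ideal on a chart -/

section Trace

variable {f : S} {e : D} {p : Ideal S}

/-- Powers of `f` are homogeneous and outside `p`, so they cancel. -/
theorem awayMk_mem_degreeZeroTrace (hf : f ∈ 𝒜 e) (hp : IsDPrime 𝒜 p) (hfp : f ∉ p) {n : ℕ} {a : S}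
    (ha : a ∈ 𝒜 (n • e)) : Away.mk 𝒜 hf n a ha ∈ degreeZeroTrace f p ↔ a ∈ p := by
  rw [degreeZeroTrace, Ideal.mem_comap]
  change Localization.mk a _ ∈ _ ↔ _
  rw [Localization.mk_eq_mk', IsLocalization.mk'_mem_map_algebraMap_iff]
  constructor
  · rintro ⟨_, ⟨m, rfl⟩, hm⟩
    refine ((hp.mul_mem_iff ⟨_, SetLike.pow_mem_graded m hf⟩ ⟨_, ha⟩).1 hm).resolve_left
      fun h => hfp (hp.pow_mem ⟨_, hf⟩ h)
  · exact fun h => ⟨1, one_mem _, by simpa using h⟩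

theorem degreeZeroTrace_isPrime (hf : f ∈ 𝒜 e) (hp : IsDPrime 𝒜 p) (hfp : f ∉ p) :
    (degreeZeroTrace (𝒜 := 𝒜) f p).IsPrime where
  ne_top' h := by
    rw [Ideal.eq_top_iff_one, ← awayMk_self hf, awayMk_mem_degreeZeroTrace hf hp hfp] at h
    exact hfp h
  mem_or_mem' := by
    intro x y hxy
    obtain ⟨n, a, ha, rfl⟩ := Away.mk_surjective 𝒜 hf x
    obtain ⟨m, b, hb, rfl⟩ := Away.mk_surjective 𝒜 hf y
    rw [awayMk_mul, awayMk_mem_degreeZeroTrace hf hp hfp] at hxy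
    rw [awayMk_mem_degreeZeroTrace hf hp hfp, awayMk_mem_degreeZeroTrace hf hp hfp]
    exact hp.mem_or_mem a b ⟨_, ha⟩ ⟨_, hb⟩ hxy

theorem comap_awayMap_degreeZeroTrace {g x : S} {e' : D} (hf : f ∈ 𝒜 e) (hg : g ∈ 𝒜 e')
    (hx : x = f * g) (hp : IsDPrime 𝒜 p) (hfp : f ∉ p) (hgp : g ∉ p) :
    (degreeZeroTrace x p).comap (awayMap 𝒜 hg hx) = degreeZeroTrace (𝒜 := 𝒜) f p := by
  have hxp : x ∉ p := by
    rw [hx, hp.mul_mem_iff ⟨_, hf⟩ ⟨_, hg⟩]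
    exact fun h => h.elim hfp hgp
  ext z
  obtain ⟨n, a, ha, rfl⟩ := Away.mk_surjective 𝒜 hf z
  rw [Ideal.mem_comap, awayMap_mk, awayMk_mem_degreeZeroTrace _ hp hxp,
    awayMk_mem_degreeZeroTrace hf hp hfp,
    hp.mul_mem_iff ⟨_, ha⟩ ⟨_, SetLike.pow_mem_graded n hg⟩]
  exact or_iff_left fun h => hgp (hp.pow_mem ⟨_, hg⟩ h)

end Trace

/-! ### The `D`-prime ideal of a point of a chart -/

section Chart

variable {f : S} {e : D}

/-- The ideal of all `s` such that all fractions `(s c) / f ^ k` of degree zero lie in `q`, where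
`(s c)` stands for its component of degree `k • e`. -/
def chartIdeal (hf : f ∈ 𝒜 e) (q : Ideal (Away 𝒜 f)) : Ideal S where
  -- Letting `c` range over all of `S` reduces closure under multiplication by `r` to replacing `c`
  -- by `r * c`.
  carrier := {s | ∀ (c : S) (k : ℕ),
    Away.mk 𝒜 hf k (DirectSum.decompose 𝒜 (s * c) (k • e) : S) (SetLike.coe_mem _) ∈ q}
  zero_mem' c k := by
    rw [awayMk_congr hf (b := 0) (by simp), awayMk_zero]
    exact zero_mem q
  add_mem' := by
    intro a b ha hb c k
    rw [awayMk_congr hf (b := (DirectSum.decompose 𝒜 (a * c) (k • e) : S) +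
      DirectSum.decompose 𝒜 (b * c) (k • e)) (by simp [add_mul]),
      awayMk_add hf (SetLike.coe_mem _) (SetLike.coe_mem _)]
    exact add_mem (ha c k) (hb c k)
  smul_mem' := by
    intro r s hs c k
    rw [awayMk_congr hf (b := (DirectSum.decompose 𝒜 (s * (r * c)) (k • e) : S))
      (by rw [smul_eq_mul, mul_comm r s, mul_assoc])]
    exact hs (r * c) k

variable (hf : f ∈ 𝒜 e) {q : Ideal (Away 𝒜 f)}

theorem awayMk_mul_mem_of_mem_chartIdeal {s c : S} (hs : s ∈ chartIdeal hf q) {k : ℕ}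
    (h : s * c ∈ 𝒜 (k • e)) : Away.mk 𝒜 hf k (s * c) h ∈ q := by
  have := hs c k
  rwa [awayMk_congr hf (DirectSum.decompose_of_mem_same 𝒜 h)] at this

theorem mem_chartIdeal_iff {s : S} {d : D} (hs : s ∈ 𝒜 d) :
    s ∈ chartIdeal hf q ↔ ∀ (k : ℕ) (c : S), c ∈ 𝒜 (k • e - d) →
      ∀ h : s * c ∈ 𝒜 (k • e), Away.mk 𝒜 hf k (s * c) h ∈ q := by
  refine ⟨fun H k c _ h => awayMk_mul_mem_of_mem_chartIdeal hf H h, fun H c k => ?_⟩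
  have h1 : (DirectSum.decompose 𝒜 (s * c) (k • e) : S) =
      s * DirectSum.decompose 𝒜 c (k • e - d) := by
    rw [← DirectSum.coe_decompose_mul_add_of_left_mem 𝒜 hs, add_sub_cancel]
  rw [awayMk_congr hf h1]
  exact H k _ (SetLike.coe_mem _) _

theorem chartIdeal_isHomogeneous : (chartIdeal hf q).IsHomogeneous 𝒜 := by
  intro d s hs
  rw [mem_chartIdeal_iff hf (SetLike.coe_mem _)]
  intro k c hc h
  have := hs c k
  rwa [awayMk_congr hf (b := (DirectSum.decompose 𝒜 s d : S) * c) (by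
    rw [← DirectSum.coe_decompose_mul_add_of_right_mem 𝒜 hc, add_sub_cancel])] at this

theorem mem_chartIdeal_of_awayMk_mem {n : ℕ} {a : S} {ha : a ∈ 𝒜 (n • e)}
    (h : Away.mk 𝒜 hf n a ha ∈ q) : a ∈ chartIdeal hf q := by
  rw [mem_chartIdeal_iff hf ha]
  intro k c hc hac
  -- `k - n` may be negative, so `a * c / f ^ k` is factored as `(a / f ^ n) * (c * f ^ n / f ^ k)`.
  have hc' : c * f ^ n ∈ 𝒜 (k • e) := by
    have := SetLike.mul_mem_graded hc (SetLike.pow_mem_graded n hf)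
    rwa [sub_add_cancel] at this
  rw [awayMk_eq_of_mul_eq hf hac (mul_mem_graded_nsmul ha hc') (by ring),
    ← awayMk_mul hf ha hc']
  exact q.mul_mem_right _ h

theorem awayMk_mem_iff_mem_chartIdeal {n : ℕ} {a : S} (ha : a ∈ 𝒜 (n • e)) :
    Away.mk 𝒜 hf n a ha ∈ q ↔ a ∈ chartIdeal hf q := by
  refine ⟨mem_chartIdeal_of_awayMk_mem hf, fun h => ?_⟩
  have := awayMk_mul_mem_of_mem_chartIdeal hf (c := 1) h (by rwa [mul_one])
  rwa [awayMk_congr hf (mul_one a)] at this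

theorem notMem_chartIdeal (hq : q ≠ ⊤) : f ∉ chartIdeal hf q := by
  rw [← awayMk_mem_iff_mem_chartIdeal hf (n := 1) (by simpa using hf), awayMk_self]
  exact fun h => hq ((Ideal.eq_top_iff_one _).2 h)

theorem chartIdeal_isDPrime (hq : q.IsPrime) : IsDPrime 𝒜 (chartIdeal hf q) where
  isHomogeneous := chartIdeal_isHomogeneous hf
  ne_top h := notMem_chartIdeal hf hq.ne_top (h ▸ Submodule.mem_top)
  mem_or_mem := by
    rintro g h ⟨i, hg⟩ ⟨j, hh⟩ hgh
    rw [mem_chartIdeal_iff hf hg, mem_chartIdeal_iff hf hh]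
    by_contra! hcon
    obtain ⟨⟨k, c, hc, h1, hgc⟩, m, b, hb, h2, hhb⟩ := hcon
    -- The product of the two fractions outside `q` has numerator `(g * h) * (c * b)`, so it lies in
    -- `q`.
    refine (hq.mem_or_mem ?_).elim hgc hhb
    rw [awayMk_mul, awayMk_congr hf (mul_mul_mul_comm g c h b)]
    exact awayMk_mul_mem_of_mem_chartIdeal hf hgh _

theorem degreeZeroTrace_chartIdeal (hq : q.IsPrime) :
    degreeZeroTrace f (chartIdeal hf q) = q := by
  ext z
  obtain ⟨n, a, ha, rfl⟩ := Away.mk_surjective 𝒜 hf z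
  rw [awayMk_mem_degreeZeroTrace hf (chartIdeal_isDPrime hf hq) (notMem_chartIdeal hf hq.ne_top),
    awayMk_mem_iff_mem_chartIdeal]

/-- For `f` relevant, a `D`-prime ideal that does not contain `f` is determined by its trace
on `S_(f)`. -/
theorem chartIdeal_degreeZeroTrace (hfin : (supportGroup 𝒜 hf).FiniteIndex) {p : Ideal S}
    (hp : IsDPrime 𝒜 p) (hfp : f ∉ p) : chartIdeal hf (degreeZeroTrace f p) = p := by
  have key : ∀ d, ∀ a ∈ 𝒜 d, a ∈ chartIdeal hf (degreeZeroTrace f p) ↔ a ∈ p := by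
    intro d a ha
    constructor
    · intro h
      -- Relevance enters here: `a ^ (N + 1) * c` has degree `l • e`, and `c` is outside `p` because
      -- it divides a power of `f`.
      obtain ⟨N, l, c, hc, m, hm⟩ := exists_mem_graded_dvd_pow hf hfin d
      have hpow := SetLike.pow_mem_graded (N + 1) ha
      have h1 : a * (a ^ N * c) ∈ 𝒜 (l • e) := by
        rw [← mul_assoc, ← pow_succ']
        have := SetLike.mul_mem_graded hpow hc
        rwa [add_sub_cancel] at this
      have h2 := awayMk_mul_mem_of_mem_chartIdeal hf h h1
      rw [awayMk_mem_degreeZeroTrace hf hp hfp, ← mul_assoc, ← pow_succ',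
        hp.mul_mem_iff ⟨_, hpow⟩ ⟨_, hc⟩] at h2
      refine hp.pow_mem ⟨_, ha⟩ (h2.resolve_right fun hcp => hfp ?_)
      exact hp.pow_mem ⟨_, hf⟩ (Ideal.mem_of_dvd _ hm hcp)
    · intro h
      rw [mem_chartIdeal_iff hf ha]
      intro k c hc hac
      exact (awayMk_mem_degreeZeroTrace hf hp hfp hac).2 (p.mul_mem_right c h)
  ext s
  rw [(chartIdeal_isHomogeneous hf).mem_iff, hp.isHomogeneous.mem_iff]
  exact forall_congr' fun d => key d _ (SetLike.coe_mem _)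

end Chart

/-! ### The canonical identification -/

section Canonical

variable {B : Ideal S}

/-- The degree of a relevant element. -/
noncomputable def RelevantIn.degree (f : RelevantIn 𝒜 B) : D := f.2.1.choose

theorem RelevantIn.mem_degree (f : RelevantIn 𝒜 B) : f.1 ∈ 𝒜 f.degree :=
  f.2.1.choose_spec.choose

theorem RelevantIn.finiteIndex (f : RelevantIn 𝒜 B) :
    (supportGroup 𝒜 f.mem_degree).FiniteIndex :=
  f.2.1.choose_spec.choose_spec

/-- The `D`-prime ideal of a point of a chart, as a point of the `D`-prime spectrum. -/
noncomputable def chartPoint (x : ProjCharts 𝒜 B) : DProj 𝒜 B :=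
  ⟨chartIdeal x.1.mem_degree x.2.asIdeal, chartIdeal_isDPrime _ x.2.2, fun h =>
    notMem_chartIdeal x.1.mem_degree x.2.2.ne_top (h x.1.2.2)⟩

theorem notMem_chartPoint (x : ProjCharts 𝒜 B) : x.1.1 ∉ (chartPoint x).asIdeal :=
  notMem_chartIdeal _ x.2.2.ne_top

theorem degreeZeroTrace_chartPoint (x : ProjCharts 𝒜 B) :
    degreeZeroTrace x.1.1 (chartPoint x).asIdeal = x.2.asIdeal :=
  degreeZeroTrace_chartIdeal _ x.2.2

/-- Makes `chartPoint` independent of the chosen degree and gives the uniqueness behind both gluing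
and surjectivity. -/
theorem chartPoint_eq_of_trace_eq {x : ProjCharts 𝒜 B} {y : DProj 𝒜 B} (hy : x.1.1 ∉ y.asIdeal)
    (h : degreeZeroTrace x.1.1 y.asIdeal = x.2.asIdeal) : chartPoint x = y := by
  refine Subtype.ext ?_
  change chartIdeal _ _ = y.asIdeal
  rw [← h]
  exact chartIdeal_degreeZeroTrace _ x.1.finiteIndex y.2.1 hy

theorem exists_chartPoint_eq (f : RelevantIn 𝒜 B) {y : DProj 𝒜 B} (hy : f.1 ∉ y.asIdeal) :
    ∃ q : PrimeSpectrum (Away 𝒜 f.1), chartPoint (⟨f, q⟩ : ProjCharts 𝒜 B) = y :=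
  ⟨⟨_, degreeZeroTrace_isPrime f.mem_degree y.2.1 hy⟩, chartPoint_eq_of_trace_eq hy rfl⟩

/-- The prime of `S_(fg)` spreads to a `D`-prime avoiding `f` and `g`, whose traces are the two
given points. -/
theorem chartPoint_eq_of_projGlue {x y : ProjCharts 𝒜 B} (h : ProjGlue 𝒜 B x y) :
    chartPoint x = chartPoint y := by
  obtain ⟨d, e, hf, hg, r, hx, hy⟩ := h
  have hfg := SetLike.mul_mem_graded hf hg
  have hK := chartIdeal_isDPrime hfg r.2
  have hnot := notMem_chartIdeal hfg r.2.ne_top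
  have hfK : x.1.1 ∉ chartIdeal hfg r.asIdeal := fun h => hnot (Ideal.mul_mem_right _ _ h)
  have hgK : y.1.1 ∉ chartIdeal hfg r.asIdeal := fun h => hnot (Ideal.mul_mem_left _ _ h)
  let z : DProj 𝒜 B := ⟨_, hK, fun h => hfK (h x.1.2.2)⟩
  refine (chartPoint_eq_of_trace_eq (y := z) hfK ?_).trans
    (chartPoint_eq_of_trace_eq (y := z) hgK ?_).symm
  · rw [← hx]
    change degreeZeroTrace x.1.1 (chartIdeal hfg r.asIdeal) = r.asIdeal.comap _
    rw [← comap_awayMap_degreeZeroTrace hf hg rfl hK hfK hgK, degreeZeroTrace_chartIdeal hfg r.2]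
  · rw [← hy]
    change degreeZeroTrace y.1.1 (chartIdeal hfg r.asIdeal) = r.asIdeal.comap _
    rw [← comap_awayMap_degreeZeroTrace hg hf (mul_comm _ _) hK hgK hfK,
      degreeZeroTrace_chartIdeal hfg r.2]

/-- The common `D`-prime avoids `f * g`, and its trace on `S_(fg)` is the gluing point. So
`ProjGlue` is already an equivalence relation. -/
theorem projGlue_of_chartPoint_eq {x y : ProjCharts 𝒜 B} (h : chartPoint x = chartPoint y) :
    ProjGlue 𝒜 B x y := by
  have hp := (chartPoint x).2.1
  have hf := x.1.mem_degree
  have hg := y.1.mem_degree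
  have hfp := notMem_chartPoint x
  have hgp : y.1.1 ∉ (chartPoint x).asIdeal := h ▸ notMem_chartPoint y
  have hfgp : x.1.1 * y.1.1 ∉ (chartPoint x).asIdeal := fun hmem =>
    (hp.mem_or_mem _ _ ⟨_, hf⟩ ⟨_, hg⟩ hmem).elim hfp hgp
  refine ⟨_, _, hf, hg,
    ⟨_, degreeZeroTrace_isPrime (SetLike.mul_mem_graded hf hg) hp hfgp⟩, ?_, ?_⟩
  · refine PrimeSpectrum.ext ?_
    rw [← degreeZeroTrace_chartPoint x]
    exact comap_awayMap_degreeZeroTrace hf hg rfl hp hfp hgp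
  · refine PrimeSpectrum.ext ?_
    rw [← degreeZeroTrace_chartPoint y, ← h]
    exact comap_awayMap_degreeZeroTrace hg hf (mul_comm _ _) hp hgp hfp

theorem continuous_chartPoint : Continuous (chartPoint : ProjCharts 𝒜 B → DProj 𝒜 B) := by
  refine continuous_sigma fun f => continuous_iff_isClosed.2 fun Z hZ => ?_
  obtain ⟨E, -, rfl⟩ := isClosed_iff_zeroLocus.1 hZ
  rw [PrimeSpectrum.isClosed_iff_zeroLocus]
  -- By the definition of `chartIdeal`, these fractions cut out the preimage of the closed set.
  refine ⟨{z | ∃ s ∈ E, ∃ (c : S) (k : ℕ), z = Away.mk 𝒜 f.mem_degree k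
    (DirectSum.decompose 𝒜 (s * c) (k • f.degree) : S) (SetLike.coe_mem _)}, ?_⟩
  ext q
  constructor
  · rintro hq _ ⟨s, hs, c, k, rfl⟩
    exact hq hs c k
  · exact fun hq s hs c k => hq ⟨s, hs, c, k, rfl⟩

theorem isOpenMap_chartPoint : IsOpenMap (chartPoint : ProjCharts 𝒜 B → DProj 𝒜 B) := by
  refine isOpenMap_sigma.2 fun f => ?_
  refine PrimeSpectrum.isTopologicalBasis_basic_opens.isOpenMap_iff.2 ?_
  rintro _ ⟨z, rfl⟩
  obtain ⟨n, a, ha, rfl⟩ := Away.mk_surjective 𝒜 f.mem_degree z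
  -- The image of the basic open set of `a / f ^ n` consists of the `D`-primes avoiding both `f` and
  -- `a`.
  convert! (isOpen_notMem (𝒜 := 𝒜) (B := B) f.1).inter (isOpen_notMem a) using 1
  ext y
  constructor
  · rintro ⟨q, hq, rfl⟩
    exact ⟨notMem_chartPoint ⟨f, q⟩, fun h =>
      hq ((awayMk_mem_iff_mem_chartIdeal f.mem_degree ha).2 h)⟩
  · rintro ⟨hfy, hay⟩
    obtain ⟨q, rfl⟩ := exists_chartPoint_eq f hfy
    exact ⟨q, fun h => hay ((awayMk_mem_iff_mem_chartIdeal f.mem_degree ha).1 h), rfl⟩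

/-- The canonical identification of the points of the `D`-graded Proj with `D`-prime ideals. -/
noncomputable def toDProj : ProjSpace 𝒜 B → DProj 𝒜 B :=
  Quot.lift chartPoint fun _ _ => chartPoint_eq_of_projGlue

theorem isCanonical_toDProj : IsCanonical (toDProj : ProjSpace 𝒜 B → DProj 𝒜 B) :=
  fun x => ⟨notMem_chartPoint x, degreeZeroTrace_chartPoint x⟩

theorem isOpenEmbedding_toDProj :
    Topology.IsOpenEmbedding (toDProj : ProjSpace 𝒜 B → DProj 𝒜 B) := by
  refine .of_continuous_injective_isOpenMap
    (continuous_quot_lift _ continuous_chartPoint) ?_ fun U hU => ?_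
  · rintro ⟨x⟩ ⟨y⟩ h
    exact Quot.sound (projGlue_of_chartPoint_eq h)
  · convert! isOpenMap_chartPoint _ (isOpen_coinduced.1 hU) using 1
    ext y
    constructor
    · rintro ⟨⟨x⟩, hx, rfl⟩
      exact ⟨x, hx, rfl⟩
    · rintro ⟨x, hx, rfl⟩
      exact ⟨Quot.mk _ x, hx, rfl⟩

theorem toDProj_surjective (hB : B ≤ irrelevantIdeal 𝒜) (hBh : B.IsHomogeneous 𝒜) :
    Function.Surjective (toDProj : ProjSpace 𝒜 B → DProj 𝒜 B) := by
  intro y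
  obtain ⟨r, hr, hry⟩ : ∃ r, IsRelevant 𝒜 r ∧ r ∉ y.asIdeal := by
    by_contra! hcon
    exact y.2.2 (hB.trans (Ideal.span_le.2 hcon))
  obtain ⟨b, hb, hby⟩ := SetLike.not_le_iff_exists.1 y.2.2
  obtain ⟨d, hd⟩ : ∃ d, (DirectSum.decompose 𝒜 b d : S) ∉ y.asIdeal := by
    by_contra! hcon
    exact hby (y.2.1.isHomogeneous.mem_iff.2 hcon)
  have hbd : SetLike.IsHomogeneousElem 𝒜 (DirectSum.decompose 𝒜 b d : S) :=
    ⟨d, SetLike.coe_mem _⟩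
  -- The relevant `r` need not lie in `B`; multiplying by a component of `b`, in `B` since `B` is
  -- graded, corrects this and stays outside the point ideal.
  let f : RelevantIn 𝒜 B :=
    ⟨DirectSum.decompose 𝒜 b d * r, hr.mul_left hbd, B.mul_mem_right r (hBh d hb)⟩
  obtain ⟨q, hq⟩ := exists_chartPoint_eq f (y := y) fun h =>
    (y.2.1.mem_or_mem_of_left hbd h).elim hd hry
  exact ⟨Quot.mk _ ⟨f, q⟩, hq⟩

end Canonical

end MultigradedProj

open MultigradedProj in
theorem mainTheorem2 {D S : Type*} [AddCommGroup D] [AddGroup.FG D] [DecidableEq D]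
    [CommRing S] [IsDomain S] (𝒜 : D → AddSubgroup S) [GradedRing 𝒜]
    (heff : IsEffective 𝒜) (hfact : IsFactoriallyGraded 𝒜)
    (B : Ideal S) (hB : B ≤ irrelevantIdeal 𝒜) :
    (∀ E : Set S, E ⊆ B →
      ((Ideal.span E).homogeneousHull 𝒜).toIdeal.IsRadical →
      vanishingIdeal (zeroLocus E : Set (DProj 𝒜 B)) =
        (((Ideal.span E).homogeneousHull 𝒜).toIdeal.radical : Set S) ∩ B) ∧
    (∀ Y : Set (DProj 𝒜 B), closure Y = zeroLocus (vanishingIdeal Y)) ∧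
    (∃ φ : ProjSpace 𝒜 B → DProj 𝒜 B, IsCanonical φ ∧ Topology.IsOpenEmbedding φ ∧
      (B.IsHomogeneous 𝒜 → Function.Surjective φ) ∧
      ∀ Y : Set (ProjSpace 𝒜 B),
        closure Y = φ ⁻¹' zeroLocus (vanishingIdeal (φ '' Y))) := by
  refine ⟨fun E _ hE => vanishingIdeal_zeroLocus hE, closure_eq_zeroLocus_vanishingIdeal,
    toDProj, isCanonical_toDProj, isOpenEmbedding_toDProj, toDProj_surjective hB, fun Y => ?_⟩
  rw [← closure_eq_zeroLocus_vanishingIdeal]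
  exact isOpenEmbedding_toDProj.isInducing.closure_eq_preimage_closure_image Y
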